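/- Let $L$ be an even positive integer, $\beta=L^2$, and $1\le m\le M$. Let $\mu$ be Haar probability measure on the unit circle $\mathbb T\subset\mathbb C$, and consider the circular $\beta$-ensemble of $M$ particles, that is, the point process on $\mathbb T$ whose joint density with respect to $\mu^M$ is \[ f(x_1,\dots,x_M)=\frac1{M!\,Z}\prod_{j<k}^{M}|x_k-x_j|^\beta,\qquad Z=\frac1{M!}\int_{\mathbb T^M}\prod_{j<k}^{M}|x_k-x_j|^\beta\,d\mu^M(\mathbf x). \] Its $m$th correlation function $R_m:\mathbb T^m\to[0,\infty)$ is characterized, up to $\mu^m$-null sets, by $\mathbb E[N_{B_1}\cdots N_{B_m}]=\int_{B_1\times\cdots\times B_m}R_m\,d\mu^m$ for all pairwise disjoint Borel sets $B_1,\dots,B_m\subset\mathbb T$, where $N_B$ is the number of particles in $B$; it is represented by the function \[ R_m(\mathbf y)=\frac{M!}{(M-m)!}\int_{\mathbb T^{M-m}}f(y_1,\dots,y_m,x_1,\dots,x_{M-m})\,d\mu^{M-m}(\mathbf x). \] Put $M'=M-m$ and $N'=LM'$, and let $\mathbf e_0,\dots,\mathbf e_{N'-1}$ be the standard basis of $V'=\mathbb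 C^{N'}$. For an $L$-element subset $\mathfrak u=\{\mathfrak u(1)<\cdots<\mathfrak u(L)\}$ of $\{0,\dots,N'-1\}$ put \[ \mathbf e_{\mathfrak u}=\mathbf e_{\mathfrak u(1)}\wedge\cdots\wedge\mathbf e_{\mathfrak u(L)},\qquad \delta\mathfrak u=\sum_{k=1}^L\mathfrak u(k)-\frac{L(N'-1)}2,\qquad \widetilde\Delta\mathfrak u=\prod_{j<k}^{L}\frac{\mathfrak u(k)-\mathfrak u(j)}{k-j}. \] For $\omega\in\Lambda^LV'$ let the hyperpfaffian $\mathrm{PF}\,\omega$ be the coefficient of $\mathbf e_0\wedge\cdots\wedge\mathbf e_{N'-1}$ in $\omega^{\wedge M'}/M'!$, and let $[\ell(x)]_{(j)}$ denote the coefficient of $x^j$ in a Laurent polynomial $\ell(x)$. Then for every $\mathbf y=(y_1,\dots,y_m)\in\mathbb T^m$, \[ R_m(\mathbf y)=M!\binom{\beta M/2}{\beta/2,\dots,\beta/2}^{-1}\prod_{j<k}^m|y_k-y_j|^\beta\cdot\prod_{n=1}^m y_n^{-\beta(M-m)/2}\cdot\mathrm{PF}\,\gamma_{\mathbf y}, \]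 where $\gamma_{\mathbf y}\in\Lambda^LV'$ is the $L$-vector \[ \gamma_{\mathbf y}=\sum_{|\delta\mathfrak u|\le\beta m/2}\Big[x^{-\beta m/2}\prod_{j=1}^m(x-y_j)^\beta\Big]_{(\delta\mathfrak u)}\widetilde\Delta\mathfrak u\;\mathbf e_{\mathfrak u}, \] the sum being over all $L$-element subsets $\mathfrak u$ of $\{0,\dots,N'-1\}$ with $|\delta\mathfrak u|\le\beta m/2$. -/

import Mathlib

noncomputable section

namespace HyperPf

open MeasureTheory

/-! ### Point processes and correlation functions -/

open Classical in
/-- `N_B(x)`: the number of coordinates of the configuration `x` lying in `B`. -/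
def occupation {W : Type*} {M : ℕ} (B : Set W) (x : Fin M → W) : ℕ :=
  (Finset.univ.filter fun i => x i ∈ B).card

/-- `R : W^m → [0, ∞)` is an `m`-th correlation function (with respect to `μ`) of the `M`-particle
point process with joint law `P`: for pairwise disjoint measurable `B₁, …, B_m`,
`E[N_{B₁} ⋯ N_{B_m}] = ∫_{B₁ × ⋯ × B_m} R dμ^m`. -/
structure IsCorrelationFunction {W : Type*} [MeasurableSpace W] (μ : Measure W) {M : ℕ}
    (P : Measure (Fin M → W)) (m : ℕ) (R : (Fin m → W) → ℝ) : Prop where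
  measurable : Measurable R
  nonneg : ∀ y, 0 ≤ R y
  expectation_eq : ∀ B : Fin m → Set W, (∀ k, MeasurableSet (B k)) →
    (Pairwise fun j k => Disjoint (B j) (B k)) →
    ∫⁻ x, ∏ k, (occupation (B k) x : ENNReal) ∂P =
      ∫⁻ y in Set.univ.pi B, ENNReal.ofReal (R y) ∂(Measure.pi fun _ => μ)

/-! ### The circular `β`-ensemble -/

instance : MeasurableSpace Circle := borel Circle

instance : BorelSpace Circle := ⟨rfl⟩

/-- Haar probability measure on the unit circle. -/
def haarCircle : Measure Circle := Measure.haarMeasure ⊤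

/-- `∏_{j < k} |x_k - x_j|^β`. -/
def absVandermonde (β : ℕ) {n : ℕ} (x : Fin n → Circle) : ℝ :=
  ∏ k, ∏ j ∈ Finset.Iio k, ‖(x k : ℂ) - (x j : ℂ)‖ ^ β

/-- The partition function `Z = (1 / M!) ∫ ∏_{j < k} |x_k - x_j|^β dμ^M`. -/
def partitionFunction (β M : ℕ) : ℝ :=
  1 / (M.factorial : ℝ) *
    ∫ x : Fin M → Circle, absVandermonde β x ∂(Measure.pi fun _ => haarCircle)

/-- The joint density of the `M` particles with respect to `μ^M`. -/
def jointDensity (β M : ℕ) (x : Fin M → Circle) : ℝ :=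
  1 / ((M.factorial : ℝ) * partitionFunction β M) * absVandermonde β x

/-- The joint law of the `M` particles. -/
def circularEnsemble (β M : ℕ) : Measure (Fin M → Circle) :=
  (Measure.pi fun _ => haarCircle).withDensity fun x => ENNReal.ofReal (jointDensity β M x)

/-- The version of the `m`-th correlation function given by the marginal density:
`R_m(y) = M! / (M - m)! ∫ f(y₁, …, y_m, x₁, …, x_{M-m}) dμ^{M-m}(x)`. -/
def correlation (β : ℕ) {m M : ℕ} (hm : m ≤ M) (y : Fin m → Circle) : ℝ :=
  (M.factorial : ℝ) / ((M - m).factorial : ℝ) *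
    ∫ x : Fin (M - m) → Circle,
      jointDensity β M (fun i => Fin.append y x (Fin.cast (Nat.add_sub_of_le hm).symm i))
      ∂(Measure.pi fun _ => haarCircle)

/-! ### Hyperpfaffians -/

/-- The coefficient of the volume form `e_0 ∧ ⋯ ∧ e_{N-1}`; on the determinantal line this is
the Hodge star. -/
def hodgeStarTop (N : ℕ) (ω : ExteriorAlgebra ℂ (Fin N → ℂ)) : ℂ :=
  (Pi.basisFun ℂ (Fin N)).ExteriorAlgebra.coord Finset.univ ω

/-- The hyperpfaffian `PF ω = ⋆ (ω^{∧ K} / K!)` of an `L`-vector `ω` over `ℂ^{LK}`. -/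
def hyperpfaffian (L K : ℕ) (ω : ⋀[ℂ]^L (Fin (L * K) → ℂ)) : ℂ :=
  hodgeStarTop (L * K) ((K.factorial : ℂ)⁻¹ • (ω : ExteriorAlgebra ℂ (Fin (L * K) → ℂ)) ^ K)

/-- The basis `L`-vector `e_u = e_{u(1)} ∧ ⋯ ∧ e_{u(L)}`, `u(1) < ⋯ < u(L)`. -/
def basisVec {L N : ℕ} (u : Set.powersetCard (Fin N) L) : ⋀[ℂ]^L (Fin N → ℂ) :=
  exteriorPower.ιMulti_family ℂ L (Pi.basisFun ℂ (Fin N)) u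

/-- The `k`-th smallest element of `u` (with `k` starting at `0`). -/
def elt {L N : ℕ} (u : Set.powersetCard (Fin N) L) (k : Fin L) : ℕ :=
  (Finset.orderEmbOfFin u.1 u.2 k : Fin N)

/-- `δu = Σu - L (N - 1) / 2`; the division is exact when `L` is even. -/
def delta {L N : ℕ} (u : Set.powersetCard (Fin N) L) : ℤ :=
  (∑ k, (elt u k : ℤ)) - (L : ℤ) * ((N : ℤ) - 1) / 2

/-- `∏_{j < k} (u(k) - u(j)) / (k - j)`. -/
def vdm {L N : ℕ} (u : Set.powersetCard (Fin N) L) : ℂ :=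
  ∏ k : Fin L, ∏ j ∈ Finset.Iio k, ((elt u k : ℂ) - (elt u j : ℂ)) / (((k : ℕ) : ℂ) - ((j : ℕ) : ℂ))

open LaurentPolynomial in
/-- The Laurent polynomial `x^{-β m / 2} ∏_j (x - y_j)^β` (for `β` even). -/
def laurent (β : ℕ) {m : ℕ} (y : Fin m → Circle) : LaurentPolynomial ℂ :=
  T (-((β * m / 2 : ℕ) : ℤ)) * ∏ j, (T 1 - C (y j : ℂ)) ^ β

/-- The `L`-vector `γ_y` over `ℂ^{LK}`, for `β = L²`. -/
def gammaVec (L K : ℕ) {m : ℕ} (y : Fin m → Circle) : ⋀[ℂ]^L (Fin (L * K) → ℂ) :=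
  ∑ u : Set.powersetCard (Fin (L * K)) L with |delta u| ≤ ((L ^ 2 * m / 2 : ℕ) : ℤ),
    ((laurent (L ^ 2) y).coeff (delta u) * vdm u) • basisVec u

end HyperPf

end

noncomputable section

namespace HyperPf

open MeasureTheory

/-! ### Determinants -/

theorem prod_Iio_eq_prod_Ioi {R : Type*} [CommMonoid R] {n : ℕ} (f : Fin n → Fin n → R) :
    ∏ k, ∏ j ∈ Finset.Iio k, f j k = ∏ j, ∏ k ∈ Finset.Ioi j, f j k :=
  Finset.prod_comm' (by simp)

theorem prod_factorial_mul_det_choose {R : Type*} [CommRing R] [IsDomain R] {n : ℕ}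
    (v : Fin n → ℕ) :
    (∏ i : Fin n, ((i : ℕ).factorial : R)) *
        (Matrix.of fun i j : Fin n => ((v i).choose j : R)).det =
      ∏ k, ∏ j ∈ Finset.Iio k, ((v k : R) - (v j : R)) := by
  rw [prod_Iio_eq_prod_Ioi fun j k => (v k : R) - (v j : R),
    ← Matrix.det_vandermonde (fun i => (v i : R)),
    Matrix.det_eval_matrixOfPolynomials_eq_det_vandermonde (fun i => (v i : R))
      (fun i => descPochhammer R i) (fun i => descPochhammer_natDegree R i)
      (fun i => monic_descPochhammer R i), ← Matrix.det_mul_row]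
  congr 1
  ext i j
  simp [descPochhammer_eval_eq_descFactorial, Nat.descFactorial_eq_factorial_mul_choose]

theorem det_choose {n : ℕ} (v : Fin n → ℕ) :
    (Matrix.of fun i j : Fin n => ((v i).choose j : ℂ)).det =
      ∏ k, ∏ j ∈ Finset.Iio k,
        ((v k : ℂ) - (v j : ℂ)) / (((k : ℕ) : ℂ) - ((j : ℕ) : ℂ)) := by
  have h0 := prod_factorial_mul_det_choose (R := ℂ) (fun i : Fin n => (i : ℕ))
  rw [Matrix.det_of_isLowerTriangular] at h0
  · simp only [Matrix.of_apply, Nat.choose_self, Nat.cast_one, Finset.prod_const_one,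
      mul_one] at h0
    simp only [Finset.prod_div_distrib]
    rw [← prod_factorial_mul_det_choose, ← h0, mul_div_cancel_left₀]
    exact Finset.prod_ne_zero_iff.2 fun i _ => by exact_mod_cast (Nat.factorial_pos _).ne'
  · intro i j hij
    have : (i : ℕ) < j := by simpa using hij
    simp [Nat.choose_eq_zero_of_lt this]

open Polynomial in
/-- The monic polynomial `∏_{k < i / L} (X - x_k)^L · (X - x_{i / L})^{i % L}` of degree `i`. -/
def newtonPoly {R : Type*} [CommRing R] (L : ℕ) (x : ℕ → R) (i : ℕ) : R[X] :=
  (∏ k ∈ Finset.range (i / L), (X - C (x k)) ^ L) * (X - C (x (i / L))) ^ (i % L)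

section Newton

open Polynomial

variable {R : Type*} [CommRing R] (L : ℕ) (x : ℕ → R)

theorem monic_newtonPoly (i : ℕ) : (newtonPoly L x i).Monic :=
  (monic_prod_of_monic _ _ fun k _ => (monic_X_sub_C (x k)).pow L).mul ((monic_X_sub_C _).pow _)

theorem natDegree_newtonPoly [Nontrivial R] (i : ℕ) : (newtonPoly L x i).natDegree = i := by
  rw [newtonPoly, Monic.natDegree_mul
    (monic_prod_of_monic _ _ fun k _ => (monic_X_sub_C (x k)).pow L) ((monic_X_sub_C _).pow _),
    natDegree_prod_of_monic _ _ fun k _ => (monic_X_sub_C (x k)).pow L,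
    (monic_X_sub_C _).natDegree_pow]
  simp only [(monic_X_sub_C _).natDegree_pow, natDegree_X_sub_C, Finset.sum_const,
    Finset.card_range, smul_eq_mul, mul_one]
  rw [mul_comm]
  exact Nat.div_add_mod i L

theorem taylor_X_sub_C_pow_mul (r : R) (n : ℕ) (p : R[X]) :
    taylor r ((X - C r) ^ n * p) = X ^ n * taylor r p := by
  rw [taylor_mul, taylor_pow]
  simp

theorem coeff_taylor_newtonPoly_of_lt (hL : 0 < L) {i j : ℕ} (hij : i < j) :
    (taylor (x (i / L)) (newtonPoly L x j)).coeff (i % L) = 0 := by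
  rcases (Nat.div_le_div_right hij.le : i / L ≤ j / L).lt_or_eq with h | h
  · rw [newtonPoly, ← Finset.mul_prod_erase _ _ (Finset.mem_range.2 h), mul_assoc,
      taylor_X_sub_C_pow_mul, coeff_X_pow_mul', if_neg (Nat.mod_lt _ hL).not_ge]
  · have : i % L < j % L := by
      have h1 := Nat.div_add_mod i L
      have h2 := Nat.div_add_mod j L
      rw [h] at h1
      omega
    rw [newtonPoly, h, mul_comm, taylor_X_sub_C_pow_mul, coeff_X_pow_mul', if_neg this.not_ge]

theorem coeff_taylor_newtonPoly_self (i : ℕ) :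
    (taylor (x (i / L)) (newtonPoly L x i)).coeff (i % L) =
      ∏ k ∈ Finset.range (i / L), (x (i / L) - x k) ^ L := by
  rw [newtonPoly, mul_comm, taylor_X_sub_C_pow_mul, coeff_X_pow_mul', if_pos le_rfl]
  simp [taylor_coeff_zero, eval_prod]

theorem prod_range_mul_div (hL : 0 < L) (d : ℕ → R) (K : ℕ) :
    ∏ i ∈ Finset.range (L * K), d (i / L) = ∏ k ∈ Finset.range K, d k ^ L := by
  induction K with
  | zero => simp
  | succ K ih =>
    rw [Nat.mul_succ, Finset.prod_range_add, ih, Finset.prod_range_succ]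
    congr 1
    rw [Finset.prod_congr rfl fun i hi => ?_, Finset.prod_const, Finset.card_range]
    rw [Nat.mul_add_div hL, Nat.div_eq_of_lt (Finset.mem_range.1 hi), add_zero]

/-- The confluent Vandermonde determinant with `K` nodes, each of multiplicity `L`. -/
theorem det_confluent_vandermonde (hL : 0 < L) (K : ℕ) :
    (Matrix.of fun i n : Fin (L * K) =>
      ((n : ℕ).choose ((i : ℕ) % L) : R) * x ((i : ℕ) / L) ^ ((n : ℕ) - (i : ℕ) % L)).det =
      ∏ k ∈ Finset.range K, ∏ j ∈ Finset.range k, (x k - x j) ^ (L ^ 2) := by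
  nontriviality R
  have hmul : (Matrix.of fun i n : Fin (L * K) =>
      ((n : ℕ).choose ((i : ℕ) % L) : R) * x ((i : ℕ) / L) ^ ((n : ℕ) - (i : ℕ) % L)) *
      (Matrix.of fun i j : Fin (L * K) => (newtonPoly L x (j : ℕ)).coeff (i : ℕ)) =
      Matrix.of fun i j : Fin (L * K) =>
        (taylor (x ((i : ℕ) / L)) (newtonPoly L x j)).coeff ((i : ℕ) % L) := by
    ext i j
    have hlt : (newtonPoly L x j).natDegree < L * K := by
      rw [natDegree_newtonPoly]; exact j.2
    rw [Matrix.mul_apply, Matrix.of_apply]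
    conv_rhs => rw [(newtonPoly L x j).as_sum_range' _ hlt]
    rw [map_sum, finsetSum_coeff, ← Fin.sum_univ_eq_sum_range (fun n =>
      (taylor (x ((i : ℕ) / L)) (monomial n ((newtonPoly L x j).coeff n))).coeff ((i : ℕ) % L))]
    refine Finset.sum_congr rfl fun n _ => ?_
    rw [taylor_coeff, hasseDeriv_monomial, eval_monomial]
    simp only [Matrix.of_apply]
    ring
  have hdet := congrArg Matrix.det hmul
  rw [Matrix.det_mul, Matrix.det_matrixOfPolynomials (fun j : Fin (L * K) => newtonPoly L x j)
    (fun i => natDegree_newtonPoly L x i) (fun i => monic_newtonPoly L x i), mul_one] at hdet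
  rw [hdet, Matrix.det_of_isLowerTriangular]
  · simp only [Matrix.of_apply, coeff_taylor_newtonPoly_self]
    rw [Fin.prod_univ_eq_prod_range
      (fun i => ∏ k ∈ Finset.range (i / L), (x (i / L) - x k) ^ L),
      prod_range_mul_div L hL (fun q => ∏ k ∈ Finset.range q, (x q - x k) ^ L)]
    refine Finset.prod_congr rfl fun k _ => ?_
    rw [← Finset.prod_pow]
    refine Finset.prod_congr rfl fun j _ => ?_
    rw [← pow_mul, sq]
  · intro i j hij
    have : (i : ℕ) < j := by simpa using hij
    exact coeff_taylor_newtonPoly_of_lt L x hL this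

end Newton

/-! ### Exterior products -/

theorem hodgeStarTop_ιMulti {N : ℕ} (v : Fin N → Fin N → ℂ) :
    hodgeStarTop N (ExteriorAlgebra.ιMulti ℂ N v) = (Matrix.of v).det := by
  set b := Pi.basisFun ℂ (Fin N)
  have hb : b.ExteriorAlgebra.coord Finset.univ (ExteriorAlgebra.ιMulti ℂ N b) = 1 := by
    have h : ExteriorAlgebra.ιMulti ℂ N b = b.ExteriorAlgebra Finset.univ := by
      rw [ExteriorAlgebra.basis_apply_ofCard b (n := N) (by simp),
        ExteriorAlgebra.ιMulti_family]
      congr 1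
      ext1 i
      have hid : (Finset.univ : Finset (Fin N)).orderEmbOfFin (by simp) =
          (OrderIso.refl (Fin N)).toOrderEmbedding :=
        (Finset.orderEmbOfFin_unique' _ fun i => Finset.mem_univ _).symm
      simp only [Function.comp_apply, Set.powersetCard.ofFinEmbEquiv_symm_apply]
      change b i = b ((Finset.univ : Finset (Fin N)).orderEmbOfFin (by simp) i)
      rw [hid]; rfl
    rw [h]; simp
  have key := AlternatingMap.eq_smul_basis_det b
    ((b.ExteriorAlgebra.coord Finset.univ).compAlternatingMap (ExteriorAlgebra.ιMulti ℂ N))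
  have := DFunLike.congr_fun key v
  simp only [LinearMap.compAlternatingMap_apply, hb, one_smul] at this
  rw [hodgeStarTop, this, Module.Basis.det_apply, ← Matrix.det_transpose]
  congr 1

theorem prod_ofFn_ιMulti {V : Type*} [AddCommGroup V] [Module ℂ V] {L K : ℕ}
    (w : Fin (L * K) → V) :
    (List.ofFn fun k : Fin K => ExteriorAlgebra.ιMulti ℂ L fun l : Fin L =>
        w ⟨L * k + l, by
          calc L * (k : ℕ) + l < L * k + L := by gcongr; exact l.2
            _ = L * (k + 1) := by ring
            _ ≤ L * K := Nat.mul_le_mul_left _ k.2⟩).prod =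
      ExteriorAlgebra.ιMulti ℂ (L * K) w := by
  rw [ExteriorAlgebra.ιMulti_apply, List.ofFn_mul', List.prod_flatten, List.map_ofFn]
  congr 1

/-- The vector of the `l`-th divided derivatives at `x` of `1, X, …, X^{N-1}`. -/
def osculatingVec (N l : ℕ) (x : ℂ) : Fin N → ℂ :=
  fun n => ((n : ℕ).choose l : ℂ) * x ^ ((n : ℕ) - l)

theorem ιMulti_eq_sum_det {L N : ℕ} (v : Fin L → Fin N → ℂ) :
    exteriorPower.ιMulti ℂ L v =
      ∑ u : Set.powersetCard (Fin N) L,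
        (Matrix.of fun i j => v i (Finset.orderEmbOfFin u.1 u.2 j)).det • basisVec u := by
  rw [← ((Pi.basisFun ℂ (Fin N)).exteriorPower L).sum_repr (exteriorPower.ιMulti ℂ L v)]
  refine Finset.sum_congr rfl fun u _ => ?_
  rw [exteriorPower.basis_repr_apply, exteriorPower.ιMultiDual_apply_ιMulti,
    exteriorPower.basis_apply, basisVec]
  congr 1

theorem det_osculatingVec {L N : ℕ} (u : Set.powersetCard (Fin N) L) {x : ℂ} (hx : x ≠ 0) :
    (Matrix.of fun i j : Fin L =>
        osculatingVec N i x (Finset.orderEmbOfFin u.1 u.2 j)).det =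
      vdm u * x ^ ((∑ k, (elt u k : ℤ)) - ∑ k : Fin L, ((k : ℕ) : ℤ)) := by
  have h : (Matrix.of fun i j : Fin L =>
      osculatingVec N i x (Finset.orderEmbOfFin u.1 u.2 j)) =
      Matrix.of fun i j : Fin L => x ^ (-((i : ℕ) : ℤ)) *
        (Matrix.of fun i j : Fin L => x ^ (elt u j : ℤ) *
          (Matrix.of fun i j : Fin L => ((elt u i).choose j : ℂ)).transpose i j) i j := by
    ext i j
    simp only [Matrix.of_apply, Matrix.transpose_apply, osculatingVec]
    change ((elt u j).choose i : ℂ) * x ^ (elt u j - (i : ℕ)) = _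
    rcases le_or_gt (i : ℕ) (elt u j) with hle | hlt
    · rw [← zpow_natCast, Nat.cast_sub hle, sub_eq_add_neg, zpow_add₀ hx]
      ring
    · simp [Nat.choose_eq_zero_of_lt hlt]
  rw [h, Matrix.det_mul_column, Matrix.det_mul_row, Matrix.det_transpose, det_choose, vdm,
    sub_eq_add_neg, zpow_add₀ hx, ← Finset.sum_neg_distrib]
  have hz : ∀ f : Fin L → ℤ, x ^ (∑ k, f k) = ∏ k, x ^ f k := fun f => by
    induction (Finset.univ : Finset (Fin L)) using Finset.induction_on with
    | empty => simp
    | insert a s ha ih => rw [Finset.sum_insert ha, Finset.prod_insert ha, zpow_add₀ hx, ih]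
  rw [hz, hz]
  ring

/-- The exterior product of the first `L` divided derivatives of the moment curve at `x`. -/
def osculatingWedge (L N : ℕ) (x : ℂ) : ExteriorAlgebra ℂ (Fin N → ℂ) :=
  ExteriorAlgebra.ιMulti ℂ L fun l : Fin L => osculatingVec N l x

theorem osculatingWedge_eq_sum {L N : ℕ} {x : ℂ} (hx : x ≠ 0) :
    osculatingWedge L N x = ∑ u : Set.powersetCard (Fin N) L,
      (vdm u * x ^ ((∑ k, (elt u k : ℤ)) - ∑ k : Fin L, ((k : ℕ) : ℤ))) •
        (basisVec u : ExteriorAlgebra ℂ (Fin N → ℂ)) := by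
  rw [osculatingWedge, ← exteriorPower.ιMulti_apply_coe, ιMulti_eq_sum_det,
    AddSubmonoidClass.coe_finsetSum]
  refine Finset.sum_congr rfl fun u _ => ?_
  rw [Submodule.coe_smul, det_osculatingVec u hx]

theorem hodgeStarTop_prod_osculatingWedge {L K : ℕ} (hL : 0 < L) (x : Fin K → ℂ) :
    hodgeStarTop (L * K) (List.ofFn fun k => osculatingWedge L (L * K) (x k)).prod =
      ∏ k, ∏ j ∈ Finset.Iio k, (x k - x j) ^ (L ^ 2) := by
  set z : ℕ → ℂ := fun n => if h : n < K then x ⟨n, h⟩ else 0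
  have hz : ∀ k : Fin K, z k = x k := fun k => by simp [z]
  have h := prod_ofFn_ιMulti (L := L) (K := K) fun i : Fin (L * K) =>
    osculatingVec (L * K) ((i : ℕ) % L) (z ((i : ℕ) / L))
  have h2 : (List.ofFn fun k => osculatingWedge L (L * K) (x k)).prod =
      ExteriorAlgebra.ιMulti ℂ (L * K) fun i : Fin (L * K) =>
        osculatingVec (L * K) ((i : ℕ) % L) (z ((i : ℕ) / L)) := by
    rw [← h]
    congr 2
    funext k
    rw [osculatingWedge]
    congr 1
    funext l
    simp only [Nat.mul_add_mod, Nat.mod_eq_of_lt l.2, Nat.mul_add_div hL,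
      Nat.div_eq_of_lt l.2, add_zero, hz]
  rw [h2, hodgeStarTop_ιMulti]
  refine (det_confluent_vandermonde L z hL K).trans ?_
  rw [← Fin.prod_univ_eq_prod_range (fun k => ∏ j ∈ Finset.range k, (z k - z j) ^ (L ^ 2))]
  refine Finset.prod_congr rfl fun k _ => ?_
  rw [← Nat.Iio_eq_range, ← Fin.map_valEmbedding_Iio, Finset.prod_map]
  simp [hz]

/-! ### Integration over the torus -/

instance : haarCircle.IsHaarMeasure := by unfold haarCircle; infer_instance

instance : IsProbabilityMeasure haarCircle := by
  have h := Measure.haarMeasure_self (K₀ := (⊤ : TopologicalSpace.PositiveCompacts Circle))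
  exact ⟨by simpa [haarCircle] using h⟩

/-- Haar probability measure on the torus `𝕋^n`. -/
abbrev haarTorus (n : ℕ) : Measure (Fin n → Circle) := Measure.pi fun _ => haarCircle

theorem integrable_of_continuous_of_compactSpace {X E : Type*} [TopologicalSpace X]
    [CompactSpace X] [MeasurableSpace X] [OpensMeasurableSpace X] [NormedAddCommGroup E]
    {μ : Measure X} [IsFiniteMeasure μ] {f : X → E} (hf : Continuous f) : Integrable f μ :=
  hf.integrable_of_hasCompactSupport (HasCompactSupport.of_compactSpace f)

@[fun_prop]
theorem continuous_coe_circle : Continuous fun x : Circle => (x : ℂ) := continuous_subtype_val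

@[fun_prop]
theorem continuous_coe_zpow (n : ℤ) : Continuous fun x : Circle => (x : ℂ) ^ n := by
  have : (fun x : Circle => (x : ℂ) ^ n) = fun x => ((x ^ n : Circle) : ℂ) := by
    ext x; simp
  rw [this]
  exact continuous_coe_circle.comp (continuous_zpow n)

theorem integral_zpow (n : ℤ) :
    ∫ x : Circle, (x : ℂ) ^ n ∂haarCircle = if n = 0 then 1 else 0 := by
  split_ifs with hn
  · simp [hn]
  · set g : Circle := Circle.exp (Real.pi / n)
    have hg : (g : ℂ) ^ n = -1 := by
      rw [← Circle.coe_zpow, ← Circle.exp_intCast_mul,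
        mul_div_cancel₀ _ (by exact_mod_cast hn : (n : ℝ) ≠ 0)]
      simp
    have h := integral_mul_left_eq_self (μ := haarCircle) (fun x : Circle => (x : ℂ) ^ n) g
    simp only [Circle.coe_mul, mul_zpow, hg, integral_const_mul] at h
    have : (2 : ℂ) * ∫ x : Circle, (x : ℂ) ^ n ∂haarCircle = 0 := by linear_combination -h
    simpa using this

theorem integral_eval_inv (p : Polynomial ℂ) :
    ∫ x : Circle, p.eval ((x : ℂ)⁻¹) ∂haarCircle = p.eval 0 := by
  simp_rw [Polynomial.eval_eq_sum_range]
  rw [integral_finsetSum]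
  · refine Finset.sum_congr rfl fun i _ => ?_
    have : ∀ x : Circle, ((x : ℂ)⁻¹) ^ i = (x : ℂ) ^ (-(i : ℤ)) := fun x => by simp
    simp_rw [this]
    rw [integral_const_mul, integral_zpow]
    rcases i with _ | i
    · simp
    · simp; omega
  · intro i _
    have : ∀ x : Circle, ((x : ℂ)⁻¹) ^ i = (x : ℂ) ^ (-(i : ℤ)) := fun x => by simp
    simp_rw [this]
    exact integrable_of_continuous_of_compactSpace (by fun_prop)

/-- The value of a Laurent polynomial at a point of the circle. -/
def laurentEval (x : Circle) : LaurentPolynomial ℂ →+* ℂ :=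
  LaurentPolynomial.eval₂ (RingHom.id ℂ) (Circle.toUnits x)

theorem laurentEval_T (x : Circle) (n : ℤ) :
    laurentEval x (LaurentPolynomial.T n) = (x : ℂ) ^ n := by
  simp [laurentEval]

theorem laurentEval_C (x : Circle) (a : ℂ) :
    laurentEval x (LaurentPolynomial.C a) = a := by
  simp [laurentEval]

theorem continuous_laurentEval (p : LaurentPolynomial ℂ) :
    Continuous fun x : Circle => laurentEval x p := by
  induction p using LaurentPolynomial.induction_on' with
  | add p q hp hq =>
    simp only [map_add]
    exact hp.add hq
  | C_mul_T n a =>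
    simp only [map_mul, laurentEval_T, laurentEval_C]
    fun_prop

theorem integral_laurentEval_mul_zpow (p : LaurentPolynomial ℂ) (d : ℤ) :
    ∫ x : Circle, laurentEval x p * (x : ℂ) ^ (-d) ∂haarCircle = p.coeff d := by
  induction p using LaurentPolynomial.induction_on' with
  | add p q hp hq =>
    simp only [map_add, add_mul]
    rw [integral_add, hp, hq]
    · simp
    all_goals
      exact integrable_of_continuous_of_compactSpace
        ((continuous_laurentEval _).mul (continuous_coe_zpow _))
  | C_mul_T n a =>
    have : ∀ x : Circle, laurentEval x (LaurentPolynomial.C a * LaurentPolynomial.T n) *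
        (x : ℂ) ^ (-d) = a * (x : ℂ) ^ (n - d) := fun x => by
      rw [map_mul, laurentEval_T, laurentEval_C, sub_eq_add_neg,
        zpow_add₀ (Circle.coe_ne_zero x), mul_assoc]
    simp_rw [this]
    rw [integral_const_mul, integral_zpow, ← LaurentPolynomial.single_eq_C_mul_T]
    simp [Finsupp.single_apply, sub_eq_zero, -LaurentPolynomial.single_eq_C_mul_T]

/-! ### The Dyson constant term identity -/

/-- `∏_{i ≠ j} (1 - x_i / x_j)^{a_i}`. -/
def dysonProd {n : ℕ} (a : Fin n → ℕ) (x : Fin n → Circle) : ℂ :=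
  ∏ i, ∏ j, if i = j then 1 else (1 - (x i : ℂ) * (x j : ℂ)⁻¹) ^ a i

theorem continuous_dysonProd {n : ℕ} (a : Fin n → ℕ) : Continuous (dysonProd a) := by
  refine continuous_finsetProd _ fun i _ => continuous_finsetProd _ fun j _ => ?_
  split_ifs
  · exact continuous_const
  · have : ∀ x : Fin n → Circle, ((x j : ℂ))⁻¹ = (x j : ℂ) ^ (-1 : ℤ) := by simp
    simp_rw [this]
    exact (continuous_const.sub ((continuous_coe_circle.comp (continuous_apply i)).mul
      ((continuous_coe_zpow _).comp (continuous_apply j)))).pow _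

theorem sum_prod_one_sub_div_inv {n : ℕ} (hn : 0 < n) {x : Fin n → ℂ}
    (hx : Function.Injective x) (hx0 : ∀ i, x i ≠ 0) :
    ∑ i, ∏ j ∈ Finset.univ.erase i, (1 - x i * (x j)⁻¹)⁻¹ = 1 := by
  have : Nonempty (Fin n) := ⟨⟨0, hn⟩⟩
  have h := congrArg (Polynomial.eval 0)
    (Lagrange.sum_basis (s := Finset.univ) (v := x) hx.injOn Finset.univ_nonempty)
  rw [Polynomial.eval_finsetSum, Polynomial.eval_one] at h
  refine (Finset.sum_congr rfl fun i _ => ?_).trans h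
  rw [Lagrange.basis, Polynomial.eval_prod]
  refine Finset.prod_congr rfl fun j hj => ?_
  have hij : x i - x j ≠ 0 := sub_ne_zero.2 fun e => (Finset.mem_erase.1 hj).1 (hx e).symm
  have hji : x j - x i ≠ 0 := sub_ne_zero.2 fun e => (Finset.mem_erase.1 hj).1 (hx e)
  have h0 := hx0 j
  simp only [Lagrange.basisDivisor, Polynomial.eval_mul, Polynomial.eval_C, Polynomial.eval_sub,
    Polynomial.eval_X, zero_sub]
  have : 1 - x i * (x j)⁻¹ = (x j - x i) * (x j)⁻¹ := by field_simp
  rw [this]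
  field_simp
  ring

theorem dysonProd_eq_zero {n : ℕ} {a : Fin n → ℕ} {x : Fin n → Circle} {p q : Fin n}
    (hpq : p ≠ q) (hx : x p = x q) (ha : 1 ≤ a p) : dysonProd a x = 0 := by
  refine Finset.prod_eq_zero (Finset.mem_univ p) (Finset.prod_eq_zero (Finset.mem_univ q) ?_)
  rw [if_neg hpq, hx, mul_inv_cancel₀ (Circle.coe_ne_zero _), sub_self, zero_pow (by omega)]

theorem dysonProd_eq_mul {n : ℕ} {a : Fin n → ℕ} (x : Fin n → Circle) (i : Fin n)
    (ha : 1 ≤ a i) :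
    dysonProd a x = dysonProd (Function.update a i (a i - 1)) x *
      ∏ j ∈ Finset.univ.erase i, (1 - (x i : ℂ) * (x j : ℂ)⁻¹) := by
  rw [dysonProd, dysonProd, ← Finset.mul_prod_erase _ _ (Finset.mem_univ i),
    ← Finset.mul_prod_erase _ (fun k : Fin n => ∏ j : Fin n, if k = j then 1 else
      (1 - (x k : ℂ) * (x j : ℂ)⁻¹) ^ (Function.update a i (a i - 1)) k) (Finset.mem_univ i),
    mul_right_comm]
  congr 1
  · rw [← Finset.mul_prod_erase _ _ (Finset.mem_univ i),
      ← Finset.mul_prod_erase _ (fun j : Fin n => if i = j then 1 else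
      (1 - (x i : ℂ) * (x j : ℂ)⁻¹) ^ (Function.update a i (a i - 1)) i) (Finset.mem_univ i), mul_assoc,
      ← Finset.prod_mul_distrib]
    simp only [if_true]
    congr 1
    refine Finset.prod_congr rfl fun j hj => ?_
    rw [if_neg (Finset.mem_erase.1 hj).1.symm, if_neg (Finset.mem_erase.1 hj).1.symm, ← pow_succ]
    congr 1
    simp
    omega
  · refine Finset.prod_congr rfl fun k hk => Finset.prod_congr rfl fun j _ => ?_
    rw [Function.update_of_ne (Finset.mem_erase.1 hk).1]

theorem dysonProd_eq_sum {n : ℕ} (hn : 0 < n) {a : Fin n → ℕ} (ha : ∀ i, 1 ≤ a i)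
    (x : Fin n → Circle) :
    dysonProd a x = ∑ i, dysonProd (Function.update a i (a i - 1)) x := by
  by_cases hx : Function.Injective x
  · have hx' : Function.Injective fun i => (x i : ℂ) := Circle.coe_injective.comp hx
    have h := sum_prod_one_sub_div_inv hn hx' fun i => Circle.coe_ne_zero _
    rw [← mul_one (dysonProd a x), ← h, Finset.mul_sum]
    refine Finset.sum_congr rfl fun i _ => ?_
    rw [dysonProd_eq_mul x i (ha i), mul_assoc, ← Finset.prod_mul_distrib,
      Finset.prod_eq_one, mul_one]
    intro j hj
    refine mul_inv_cancel₀ fun h0 => (Finset.mem_erase.1 hj).1 (hx' ?_)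
    have := Circle.coe_ne_zero (x j)
    field_simp at h0
    simpa [sub_eq_zero] using h0
  · obtain ⟨p, q, hpq, hne⟩ : ∃ p q, x p = x q ∧ p ≠ q := by
      simpa [Function.Injective] using hx
    rw [dysonProd_eq_zero hne hpq (ha p), Finset.sum_eq_zero]
    intro i _
    by_cases hi : i = p
    · refine dysonProd_eq_zero hne.symm hpq.symm ?_
      rw [Function.update_of_ne (hi ▸ hne.symm : q ≠ i)]
      exact ha q
    · refine dysonProd_eq_zero hne hpq ?_
      rw [Function.update_of_ne (Ne.symm hi : p ≠ i)]
      exact ha p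

theorem multinomial_eq_sum {n : ℕ} (hn : 0 < n) {a : Fin n → ℕ} (ha : ∀ i, 1 ≤ a i) :
    Nat.multinomial Finset.univ a =
      ∑ i, Nat.multinomial Finset.univ (Function.update a i (a i - 1)) := by
  have hpos : 0 < ∏ i, (a i).factorial := Finset.prod_pos fun i _ => Nat.factorial_pos _
  refine Nat.eq_of_mul_eq_mul_left hpos ?_
  rw [Nat.multinomial_spec, Finset.mul_sum]
  have hs : 1 ≤ ∑ i, a i :=
    (ha ⟨0, hn⟩).trans (Finset.single_le_sum (fun _ _ => Nat.zero_le _) (Finset.mem_univ _))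
  have h : ∀ i, (∏ k, (a k).factorial) * Nat.multinomial Finset.univ (Function.update a i (a i - 1)) =
      a i * (∑ k, a k - 1).factorial := fun i => by
    have h1 : ∏ k, (a k).factorial = a i * ∏ k, ((Function.update a i (a i - 1)) k).factorial := by
      rw [← Finset.mul_prod_erase _ _ (Finset.mem_univ i),
        ← Finset.mul_prod_erase _ (fun k => ((Function.update a i (a i - 1)) k).factorial)
          (Finset.mem_univ i), ← mul_assoc]
      congr 1
      · simpa using (Nat.mul_factorial_pred (by have := ha i; omega : a i ≠ 0)).symm
      · refine Finset.prod_congr rfl fun k hk => ?_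
        rw [Function.update_of_ne (Finset.mem_erase.1 hk).1]
    have h2 : ∑ k, (Function.update a i (a i - 1)) k = ∑ k, a k - 1 := by
      rw [← Finset.add_sum_erase _ _ (Finset.mem_univ i),
        ← Finset.add_sum_erase _ a (Finset.mem_univ i),
        Finset.sum_congr rfl fun k hk => show (Function.update a i (a i - 1)) k = a k by
          rw [Function.update_of_ne (Finset.mem_erase.1 hk).1]]
      rw [Function.update_self]
      exact (Nat.sub_add_comm (ha i)).symm
    rw [h1, mul_assoc, Nat.multinomial_spec, h2]
  rw [Finset.sum_congr rfl fun i _ => h i, ← Finset.sum_mul]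
  exact (Nat.mul_factorial_pred (by omega)).symm

theorem multinomial_succAbove {n : ℕ} {a : Fin (n + 1) → ℕ} {i : Fin (n + 1)} (ha : a i = 0) :
    Nat.multinomial Finset.univ a = Nat.multinomial Finset.univ fun j => a (i.succAbove j) := by
  have hpos : 0 < ∏ i, (a i).factorial := Finset.prod_pos fun i _ => Nat.factorial_pos _
  refine Nat.eq_of_mul_eq_mul_left hpos ?_
  rw [Nat.multinomial_spec, Fin.prod_univ_succAbove _ i, Fin.sum_univ_succAbove _ i, ha,
    Nat.factorial_zero, one_mul, zero_add, Nat.multinomial_spec]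

theorem dysonProd_insertNth {n : ℕ} {a : Fin (n + 1) → ℕ} {i : Fin (n + 1)} (ha : a i = 0)
    (t : Circle) (z : Fin n → Circle) :
    dysonProd a (i.insertNth (α := fun _ => Circle) t z) =
      (∏ j, (1 - (z j : ℂ) * (t : ℂ)⁻¹) ^ a (i.succAbove j)) *
        dysonProd (fun j => a (i.succAbove j)) z := by
  rw [dysonProd, Fin.prod_univ_succAbove _ i]
  simp only [Fin.prod_univ_succAbove _ i, ha, pow_zero, ite_self, Finset.prod_const_one, mul_one,
    one_mul, Fin.insertNth_apply_same, Fin.insertNth_apply_succAbove, Fin.succAbove_ne, if_false,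
    Fin.succAbove_right_inj, Finset.prod_mul_distrib, dysonProd]

theorem integral_dysonProd_of_eq_zero {n : ℕ} {a : Fin (n + 1) → ℕ} {i : Fin (n + 1)}
    (ha : a i = 0) :
    ∫ x, dysonProd a x ∂(haarTorus (n + 1)) =
      ∫ x, dysonProd (fun j => a (i.succAbove j)) x ∂(haarTorus n) := by
  have hmp := (measurePreserving_piFinSuccAbove (fun _ : Fin (n + 1) => haarCircle) i).symm
  rw [haarTorus, ← hmp.integral_comp' (fun x => dysonProd a x)]
  change ∫ p : Circle × (Fin n → Circle),
    dysonProd a (i.insertNth (α := fun _ => Circle) p.1 p.2) ∂_ = _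
  rw [integral_prod_symm]
  · refine integral_congr_ae (Filter.Eventually.of_forall fun z => ?_)
    simp only [dysonProd_insertNth ha]
    rw [integral_mul_const]
    have h := integral_eval_inv
      (∏ j, (1 - Polynomial.C (z j : ℂ) * Polynomial.X) ^ a (i.succAbove j))
    simp only [Polynomial.eval_prod, Polynomial.eval_pow, Polynomial.eval_sub,
      Polynomial.eval_one, Polynomial.eval_mul, Polynomial.eval_C, Polynomial.eval_X, mul_zero,
      sub_zero, one_pow, Finset.prod_const_one] at h
    rw [h, one_mul]
  · refine integrable_of_continuous_of_compactSpace ((continuous_dysonProd a).comp ?_)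
    exact Continuous.finInsertNth i continuous_fst continuous_snd

theorem integral_dysonProd {n : ℕ} (a : Fin n → ℕ) :
    ∫ x, dysonProd a x ∂(haarTorus n) = (Nat.multinomial Finset.univ a : ℂ) := by
  induction n with
  | zero => simp [dysonProd]
  | succ n ihn =>
    induction hs : ∑ i, a i using Nat.strong_induction_on generalizing a with
    | _ s ihs =>
      by_cases h : ∃ i, a i = 0
      · obtain ⟨i, hi⟩ := h
        rw [integral_dysonProd_of_eq_zero hi, ihn, multinomial_succAbove hi]
      · have ha : ∀ i, 1 ≤ a i := fun i => Nat.one_le_iff_ne_zero.2 fun hi => h ⟨i, hi⟩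
        simp_rw [dysonProd_eq_sum n.succ_pos ha]
        rw [integral_finsetSum _ fun i _ =>
          integrable_of_continuous_of_compactSpace (continuous_dysonProd _),
          multinomial_eq_sum n.succ_pos ha, Nat.cast_sum]
        refine Finset.sum_congr rfl fun i _ => ihs _ ?_ _ rfl
        rw [← hs]
        refine Finset.sum_lt_sum (fun k _ => ?_) ⟨i, Finset.mem_univ _, ?_⟩
        · rcases eq_or_ne k i with rfl | hk
          · simp
          · rw [Function.update_of_ne hk]
        · have := ha i
          rw [Function.update_self]
          omega

theorem norm_sub_sq_eq (x y : Circle) :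
    ((‖(x : ℂ) - (y : ℂ)‖ : ℝ) : ℂ) ^ 2 =
      (1 - (x : ℂ) * (y : ℂ)⁻¹) * (1 - (y : ℂ) * (x : ℂ)⁻¹) := by
  have hx := Circle.coe_ne_zero x
  have hy := Circle.coe_ne_zero y
  rw [← Complex.mul_conj', map_sub, ← Circle.coe_inv_eq_conj, ← Circle.coe_inv_eq_conj,
    Circle.coe_inv, Circle.coe_inv]
  field_simp

theorem absVandermonde_eq_dysonProd {n : ℕ} (c : ℕ) (x : Fin n → Circle) :
    (absVandermonde (2 * c) x : ℂ) = dysonProd (fun _ => c) x := by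
  have h : ∀ i : Fin n, ∀ f : Fin n → ℂ, (∏ j, if i = j then 1 else f j) =
      (∏ j ∈ Finset.Iio i, f j) * ∏ j ∈ Finset.Ioi i, f j := fun i f => by
    rw [← Finset.prod_union (Finset.disjoint_left.2 fun j h1 h2 => by
      simp only [Finset.mem_Iio, Finset.mem_Ioi] at h1 h2; exact lt_asymm h1 h2)]
    rw [← Finset.prod_subset (Finset.subset_univ (Finset.Iio i ∪ Finset.Ioi i))]
    · refine Finset.prod_congr rfl fun j hj => if_neg ?_
      rintro rfl
      simp at hj
    · intro j _ hj
      simp only [Finset.mem_union, Finset.mem_Iio, Finset.mem_Ioi, not_or, not_lt] at hj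
      exact if_pos (le_antisymm hj.1 hj.2)
  simp only [dysonProd, h, Finset.prod_mul_distrib]
  rw [← prod_Iio_eq_prod_Ioi fun i j => (1 - (x i : ℂ) * (x j : ℂ)⁻¹) ^ c,
    ← Finset.prod_mul_distrib, absVandermonde]
  push_cast
  refine Finset.prod_congr rfl fun k _ => ?_
  rw [← Finset.prod_mul_distrib]
  refine Finset.prod_congr rfl fun j _ => ?_
  rw [pow_mul, norm_sub_sq_eq, mul_pow]

theorem integral_absVandermonde (c n : ℕ) :
    ∫ x, absVandermonde (2 * c) x ∂(haarTorus n) =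
      (Nat.multinomial (Finset.univ : Finset (Fin n)) fun _ => c : ℝ) := by
  have h := integral_dysonProd (n := n) fun _ => c
  simp_rw [← absVandermonde_eq_dysonProd] at h
  rw [integral_complex_ofReal] at h
  exact_mod_cast h

/-! ### The hyperpfaffian as a torus integral -/

theorem prod_Iio_mul_eq_prod_pow {R : Type*} [CommMonoid R] {K : ℕ} (f : Fin K → R) :
    ∏ k, ∏ j ∈ Finset.Iio k, (f k * f j) = ∏ k, f k ^ (K - 1) := by
  simp only [Finset.prod_mul_distrib]
  rw [prod_Iio_eq_prod_Ioi fun j _ => f j, ← Finset.prod_mul_distrib]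
  refine Finset.prod_congr rfl fun k _ => ?_
  rw [Finset.prod_const, Finset.prod_const, ← pow_add, Fin.card_Iio, Fin.card_Ioi]
  congr 1
  omega

theorem norm_sub_sq_eq_neg_mul_sq (x y : Circle) :
    ((‖(x : ℂ) - (y : ℂ)‖ : ℝ) : ℂ) ^ 2 =
      -(((x : ℂ) * (y : ℂ)) * ((x : ℂ)⁻¹ - (y : ℂ)⁻¹) ^ 2) := by
  have hx := Circle.coe_ne_zero x
  have hy := Circle.coe_ne_zero y
  rw [norm_sub_sq_eq]
  field_simp
  ring

theorem norm_sub_pow_eq {c : ℕ} (hc : Even c) (x y : Circle) :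
    ((‖(x : ℂ) - (y : ℂ)‖ : ℝ) : ℂ) ^ (2 * c) =
      ((x : ℂ) ^ c * (y : ℂ) ^ c) * ((x : ℂ)⁻¹ - (y : ℂ)⁻¹) ^ (2 * c) := by
  rw [pow_mul, norm_sub_sq_eq_neg_mul_sq, hc.neg_pow, mul_pow, mul_pow, ← pow_mul]

theorem absVandermonde_eq_prod_inv {c K : ℕ} (hc : Even c) (x : Fin K → Circle) :
    (absVandermonde (2 * c) x : ℂ) = (∏ k, (x k : ℂ) ^ ((c : ℤ) * ((K : ℤ) - 1))) *
      ∏ k, ∏ j ∈ Finset.Iio k, ((x k : ℂ)⁻¹ - (x j : ℂ)⁻¹) ^ (2 * c) := by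
  rw [absVandermonde]
  push_cast
  simp only [norm_sub_pow_eq hc]
  simp only [Finset.prod_mul_distrib (f := fun j => (x _ : ℂ) ^ c * (x j : ℂ) ^ c)]
  rw [Finset.prod_mul_distrib, prod_Iio_mul_eq_prod_pow fun k => (x k : ℂ) ^ c]
  congr 1
  refine Finset.prod_congr rfl fun k _ => ?_
  have : ((K : ℤ) - 1) = ((K - 1 : ℕ) : ℤ) := by have := k.pos; omega
  rw [this, ← Nat.cast_mul, zpow_natCast, pow_mul]

theorem laurentEval_laurent (c : ℕ) {m : ℕ} (y : Fin m → Circle) (x : Circle) :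
    laurentEval x (laurent (2 * c) y) =
      ∏ j, ((x : ℂ) ^ (-(c : ℤ)) * ((x : ℂ) - (y j : ℂ)) ^ (2 * c)) := by
  rw [laurent, map_mul, laurentEval_T, map_prod, Finset.prod_mul_distrib, Finset.prod_const,
    Finset.card_univ, Fintype.card_fin, ← zpow_natCast, ← zpow_mul]
  congr 1
  · congr 1
    rw [mul_assoc, Nat.mul_div_cancel_left _ two_pos]
    push_cast
    ring
  · simp only [map_pow, map_sub, laurentEval_T, laurentEval_C, zpow_one]

theorem prod_norm_sub_pow_eq {c m : ℕ} (hc : Even c) (x : Circle) (y : Fin m → Circle) :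
    (∏ j, ((‖(x : ℂ) - (y j : ℂ)‖ : ℝ) : ℂ) ^ (2 * c)) =
      laurentEval x (laurent (2 * c) y) * ∏ j, (y j : ℂ) ^ (-(c : ℤ)) := by
  rw [laurentEval_laurent, ← Finset.prod_mul_distrib]
  refine Finset.prod_congr rfl fun j _ => ?_
  have hx := Circle.coe_ne_zero x
  have hy := Circle.coe_ne_zero (y j)
  rw [norm_sub_pow_eq hc, zpow_neg, zpow_neg, zpow_natCast, zpow_natCast]
  have : (x : ℂ)⁻¹ - (y j : ℂ)⁻¹ = -(((x : ℂ) - (y j : ℂ)) * (x : ℂ)⁻¹ * (y j : ℂ)⁻¹) := by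
    field_simp
    ring
  rw [this, (even_two_mul c).neg_pow, mul_pow, mul_pow, mul_comm 2 c, pow_mul _ c 2,
    pow_mul (x : ℂ)⁻¹, pow_mul (y j : ℂ)⁻¹]
  simp only [inv_pow]
  field_simp

theorem laurent_coeff_eq_zero (c : ℕ) {m : ℕ} (y : Fin m → Circle) {d : ℤ}
    (hd : ((c * m : ℕ) : ℤ) < |d|) : (laurent (2 * c) y).coeff d = 0 := by
  set p : Polynomial ℂ := ∏ j, (Polynomial.X - Polynomial.C (y j : ℂ)) ^ (2 * c) with hp
  have hdeg : p.natDegree = 2 * (c * m) := by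
    rw [hp, Polynomial.natDegree_prod_of_monic _ _ fun j _ => (Polynomial.monic_X_sub_C _).pow _]
    simp only [(Polynomial.monic_X_sub_C _).natDegree_pow, Polynomial.natDegree_X_sub_C,
      Finset.sum_const, Finset.card_univ, Fintype.card_fin, smul_eq_mul]
    ring
  have hl : laurent (2 * c) y = LaurentPolynomial.T (-((c * m : ℕ) : ℤ)) *
      Polynomial.toLaurent p := by
    rw [laurent, mul_assoc 2 c m, Nat.mul_div_cancel_left _ two_pos, hp, map_prod]
    simp
  rw [hl, p.as_sum_range_C_mul_X_pow, map_sum, Finset.mul_sum]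
  simp only [map_mul, Polynomial.toLaurent_C, Polynomial.toLaurent_X_pow]
  have : ∀ i ∈ Finset.range (p.natDegree + 1),
      (LaurentPolynomial.T (-((c * m : ℕ) : ℤ)) *
        (LaurentPolynomial.C (p.coeff i) * LaurentPolynomial.T i)).coeff d = 0 := by
    intro i hi
    have hi' := Finset.mem_range.1 hi
    rw [mul_left_comm, ← LaurentPolynomial.T_add, ← LaurentPolynomial.single_eq_C_mul_T,
      AddMonoidAlgebra.coeff_single, Finsupp.single_apply, if_neg]
    intro h
    rw [lt_abs] at hd
    omega
  rw [AddMonoidAlgebra.coeff_sum, Finsupp.finsetSum_apply]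
  exact Finset.sum_eq_zero this

theorem delta_eq {h K : ℕ} (u : Set.powersetCard (Fin ((2 * h) * K)) (2 * h)) :
    -delta u = ((2 * h ^ 2 : ℕ) : ℤ) * ((K : ℤ) - 1) -
      ((∑ k, (elt u k : ℤ)) - ∑ k : Fin (2 * h), ((k : ℕ) : ℤ)) := by
  have h1 : 2 * ∑ k : Fin (2 * h), ((k : ℕ) : ℤ) = (2 * h : ℤ) * (2 * h - 1) := by
    have := Finset.sum_range_id_mul_two (2 * h)
    rw [Fin.sum_univ_eq_sum_range (fun k => (k : ℤ)), ← Nat.cast_sum]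
    rcases Nat.eq_zero_or_pos h with rfl | hpos
    · simp
    · zify [show 1 ≤ 2 * h by omega] at this
      push_cast
      linarith
  rw [delta]
  have h2 : ((2 * h : ℕ) : ℤ) * (((2 * h * K : ℕ) : ℤ) - 1) / 2 = (h : ℤ) * (2 * h * K - 1) := by
    push_cast
    rw [mul_assoc, Int.mul_ediv_cancel_left _ two_ne_zero]
  rw [h2]
  push_cast
  nlinarith

theorem coe_gammaVec (L K : ℕ) (hL : Even L) {m : ℕ} (y : Fin m → Circle) :
    (gammaVec L K y : ExteriorAlgebra ℂ (Fin (L * K) → ℂ)) =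
      ∑ u : Set.powersetCard (Fin (L * K)) L, ((laurent (L ^ 2) y).coeff (delta u) * vdm u) •
        (basisVec u : ExteriorAlgebra ℂ (Fin (L * K) → ℂ)) := by
  obtain ⟨h, rfl⟩ := hL.two_dvd
  rw [gammaVec, AddSubmonoidClass.coe_finsetSum]
  simp only [Submodule.coe_smul]
  refine Finset.sum_subset (Finset.filter_subset _ _) fun u _ hu => ?_
  have hu' : ¬|delta u| ≤ (((2 * h) ^ 2 * m / 2 : ℕ) : ℤ) := by simpa using hu
  have h2 : (2 * h) ^ 2 = 2 * (2 * h ^ 2) := by ring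
  have h3 : (2 * h) ^ 2 * m / 2 = 2 * h ^ 2 * m := by
    rw [h2, mul_assoc 2, Nat.mul_div_cancel_left _ two_pos]
  rw [h3, not_le] at hu'
  rw [h2, laurent_coeff_eq_zero _ y hu', zero_mul, zero_smul]

/-- The fundamental identity behind de Bruijn-type integration formulas: a torus integral of
products of one-variable forms is the value on the product of the integrated forms. -/
theorem integral_prod_ofFn {A : Type*} [Ring A] [Algebra ℂ A] (φ : A →ₗ[ℂ] ℂ) {U : Type*}
    [Fintype U] (e : U → A) {g : U → Circle → ℂ} (hg : ∀ u, Continuous (g u)) (K : ℕ) :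
    ∫ x : Fin K → Circle, φ (List.ofFn fun k => ∑ u, g u (x k) • e u).prod ∂(haarTorus K) =
      φ ((∑ u, (∫ t, g u t ∂haarCircle) • e u) ^ K) := by
  classical
  have key : ∀ G : Fin K → U → ℂ, φ (List.ofFn fun k => ∑ u, G k u • e u).prod =
      ∑ r : Fin K → U, (∏ k, G k (r k)) * φ (List.ofFn fun k => e (r k)).prod := fun G => by
    have h := (MultilinearMap.mkPiAlgebraFin ℂ K A).map_sum fun k u => G k u • e u
    simp only [MultilinearMap.map_smul_univ, MultilinearMap.mkPiAlgebraFin_apply] at h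
    rw [h, map_sum]
    simp
  have hpow : (∑ u, (∫ t, g u t ∂haarCircle) • e u) ^ K =
      (List.ofFn fun _ : Fin K => ∑ u, (∫ t, g u t ∂haarCircle) • e u).prod := by
    rw [List.ofFn_const, List.prod_replicate]
  rw [hpow, key fun _ u => ∫ t, g u t ∂haarCircle]
  have key' : ∀ x : Fin K → Circle, φ (List.ofFn fun k => ∑ u, g u (x k) • e u).prod =
      ∑ r : Fin K → U, (∏ k, g (r k) (x k)) * φ (List.ofFn fun k => e (r k)).prod :=
    fun x => key fun k u => g u (x k)
  simp only [key']
  rw [integral_finsetSum]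
  · refine Finset.sum_congr rfl fun r _ => ?_
    rw [integral_mul_const, integral_fintype_prod_eq_prod (fun k => g (r k))]
  · intro r _
    refine integrable_of_continuous_of_compactSpace (Continuous.mul ?_ continuous_const)
    exact continuous_finsetProd _ fun k _ => (hg _).comp (continuous_apply k)

theorem integral_absVandermonde_mul_prod (L K : ℕ) (hL : Even L) (hL0 : 0 < L) {m : ℕ}
    (y : Fin m → Circle) :
    ∫ x : Fin K → Circle, ((absVandermonde (L ^ 2) x : ℂ) *
        ∏ k, ∏ j, ((‖(x k : ℂ) - (y j : ℂ)‖ : ℝ) : ℂ) ^ (L ^ 2)) ∂(haarTorus K) =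
      (∏ n, (y n : ℂ) ^ (-((L ^ 2 * K / 2 : ℕ) : ℤ))) *
        hodgeStarTop (L * K) ((gammaVec L K y : ExteriorAlgebra ℂ (Fin (L * K) → ℂ)) ^ K) := by
  set φ : ExteriorAlgebra ℂ (Fin (L * K) → ℂ) →ₗ[ℂ] ℂ :=
    (Pi.basisFun ℂ (Fin (L * K))).ExteriorAlgebra.coord Finset.univ
  set g : Set.powersetCard (Fin (L * K)) L → Circle → ℂ := fun u t =>
    (laurentEval t (laurent (L ^ 2) y) * (t : ℂ) ^ (-delta u)) * vdm u with hg
  have hgint : ∀ u, ∫ t, g u t ∂haarCircle = (laurent (L ^ 2) y).coeff (delta u) * vdm u :=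
    fun u => by rw [hg]; simp only; rw [integral_mul_const, integral_laurentEval_mul_zpow]
  have hgc : ∀ u, Continuous (g u) := fun u =>
    ((continuous_laurentEval _).mul (continuous_coe_zpow _)).mul continuous_const
  have hmain := integral_prod_ofFn φ
    (fun u : Set.powersetCard (Fin (L * K)) L =>
      (basisVec u : ExteriorAlgebra ℂ (Fin (L * K) → ℂ))) hgc K
  simp only [hgint, ← coe_gammaVec L K hL y] at hmain
  change _ = _ * φ _
  rw [← hmain, ← integral_const_mul]
  congr 1
  funext x
  obtain ⟨h, rfl⟩ := hL.two_dvd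
  have h2 : (2 * h) ^ 2 = 2 * (2 * h ^ 2) := by ring
  have hc : Even (2 * h ^ 2) := even_two_mul _
  have hwedge : ∀ t : Circle, ∑ u, g u t •
      (basisVec u : ExteriorAlgebra ℂ (Fin (2 * h * K) → ℂ)) =
      (laurentEval t (laurent ((2 * h) ^ 2) y) *
        (t : ℂ) ^ (((2 * h ^ 2 : ℕ) : ℤ) * ((K : ℤ) - 1))) •
          osculatingWedge (2 * h) (2 * h * K) (t : ℂ)⁻¹ := fun t => by
    have ht := Circle.coe_ne_zero t
    rw [osculatingWedge_eq_sum (inv_ne_zero ht), Finset.smul_sum]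
    refine Finset.sum_congr rfl fun u _ => ?_
    rw [smul_smul, hg]
    congr 1
    simp only
    rw [delta_eq, sub_eq_add_neg, zpow_add₀ ht, inv_zpow']
    ring
  have hprod : φ (List.ofFn fun k => ∑ u, g u (x k) •
      (basisVec u : ExteriorAlgebra ℂ (Fin (2 * h * K) → ℂ))).prod =
      (∏ k, (laurentEval (x k) (laurent ((2 * h) ^ 2) y) *
        (x k : ℂ) ^ (((2 * h ^ 2 : ℕ) : ℤ) * ((K : ℤ) - 1)))) *
      ∏ k, ∏ j ∈ Finset.Iio k, ((x k : ℂ)⁻¹ - (x j : ℂ)⁻¹) ^ ((2 * h) ^ 2) := by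
    simp only [hwedge]
    have hs := (MultilinearMap.mkPiAlgebraFin ℂ K
      (ExteriorAlgebra ℂ (Fin (2 * h * K) → ℂ))).map_smul_univ
      (fun k => laurentEval (x k) (laurent ((2 * h) ^ 2) y) *
        (x k : ℂ) ^ (((2 * h ^ 2 : ℕ) : ℤ) * ((K : ℤ) - 1)))
      (fun k => osculatingWedge (2 * h) (2 * h * K) (x k : ℂ)⁻¹)
    simp only [MultilinearMap.mkPiAlgebraFin_apply] at hs
    rw [hs, map_smul, smul_eq_mul]
    congr 1
    exact hodgeStarTop_prod_osculatingWedge hL0 fun k => (x k : ℂ)⁻¹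
  rw [hprod]
  simp only [h2]
  rw [absVandermonde_eq_prod_inv hc]
  simp only [prod_norm_sub_pow_eq hc]
  have hy : ∏ n, (y n : ℂ) ^ (-((2 * (2 * h ^ 2) * K / 2 : ℕ) : ℤ)) =
      ∏ _k : Fin K, ∏ j, (y j : ℂ) ^ (-((2 * h ^ 2 : ℕ) : ℤ)) := by
    rw [Finset.prod_const, Finset.card_univ, Fintype.card_fin, ← Finset.prod_pow]
    refine Finset.prod_congr rfl fun n _ => ?_
    rw [← zpow_natCast, ← zpow_mul, mul_assoc 2, Nat.mul_div_cancel_left _ two_pos]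
    congr 1
    push_cast
    ring
  rw [hy, Finset.prod_mul_distrib, Finset.prod_mul_distrib]
  ring

/-! ### Splitting a configuration -/

/-- The configuration `(y₁, …, y_m, x₁, …, x_{M-m})`. -/
def join {W : Type*} {m M : ℕ} (hm : m ≤ M) (y : Fin m → W) (x : Fin (M - m) → W) : Fin M → W :=
  fun i => Fin.append y x (Fin.cast (Nat.add_sub_of_le hm).symm i)

/-- The bijection of index sets behind `join`. -/
def joinIndex {m M : ℕ} (hm : m ≤ M) : Fin m ⊕ Fin (M - m) ≃ Fin M :=
  finSumFinEquiv.trans (finCongr (Nat.add_sub_of_le hm))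

section Join

variable {W : Type*} {m M : ℕ} (hm : m ≤ M)

theorem join_inl (y : Fin m → W) (x : Fin (M - m) → W) (i : Fin m) :
    join hm y x (joinIndex hm (Sum.inl i)) = y i := by
  simp [join, joinIndex]

theorem join_inr (y : Fin m → W) (x : Fin (M - m) → W) (i : Fin (M - m)) :
    join hm y x (joinIndex hm (Sum.inr i)) = x i := by
  simp [join, joinIndex]

theorem measurePreserving_join [MeasurableSpace W] (μ : Measure W) [SigmaFinite μ] :
    MeasurePreserving (fun p : (Fin m → W) × (Fin (M - m) → W) => join hm p.1 p.2)
      ((Measure.pi fun _ => μ).prod (Measure.pi fun _ => μ)) (Measure.pi fun _ => μ) := by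
  have h1 := (measurePreserving_sumPiEquivProdPi
    (fun _ : Fin m ⊕ Fin (M - m) => μ)).symm
  have h2 := measurePreserving_piCongrLeft (fun _ : Fin M => μ) (joinIndex hm)
  convert! h2.comp h1 using 1
  funext p i
  obtain ⟨s, rfl⟩ := (joinIndex hm).surjective i
  rw [Function.comp_apply, MeasurableEquiv.coe_piCongrLeft, Equiv.piCongrLeft_apply_apply]
  rcases s with i | i
  · exact join_inl hm _ _ i
  · exact join_inr hm _ _ i

theorem measurable_join [MeasurableSpace W] :
    Measurable fun p : (Fin m → W) × (Fin (M - m) → W) => join hm p.1 p.2 := by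
  refine measurable_pi_lambda _ fun i => ?_
  obtain ⟨s, rfl⟩ := (joinIndex hm).surjective i
  rcases s with i | i
  · simp only [join_inl]
    fun_prop
  · simp only [join_inr]
    fun_prop

theorem continuous_join [TopologicalSpace W] (y : Fin m → W) : Continuous (join hm y) := by
  refine continuous_pi fun i => ?_
  obtain ⟨s, rfl⟩ := (joinIndex hm).surjective i
  rcases s with i | i
  · simp only [join_inl]
    fun_prop
  · simp only [join_inr]
    fun_prop

end Join

/-! ### Correlation functions of symmetric densities -/

theorem natCast_occupation {W : Type*} {M : ℕ} (B : Set W) (x : Fin M → W) :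
    (occupation B x : ENNReal) = ∑ i, B.indicator 1 (x i) := by
  classical
  rw [occupation, Finset.card_filter]
  push_cast
  refine Finset.sum_congr rfl fun i _ => ?_
  by_cases h : x i ∈ B <;> simp [h]

theorem prod_indicator_eq {W : Type*} {m : ℕ} (B : Fin m → Set W) (y : Fin m → W) :
    ∏ k, (B k).indicator (1 : W → ENNReal) (y k) =
      (Set.univ.pi B).indicator (1 : (Fin m → W) → ENNReal) y := by
  classical
  by_cases h : y ∈ Set.univ.pi B
  · rw [Set.indicator_of_mem h, Pi.one_apply]
    exact Finset.prod_eq_one fun k _ => by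
      rw [Set.indicator_of_mem (h k (Set.mem_univ k)), Pi.one_apply]
  · rw [Set.indicator_of_notMem h]
    obtain ⟨k, hk⟩ : ∃ k, y k ∉ B k := by simpa [Set.mem_pi] using h
    exact Finset.prod_eq_zero (Finset.mem_univ k) (Set.indicator_of_notMem hk _)

theorem exists_perm_extending {α β : Type*} [Finite β] {f g : α → β}
    (hf : Function.Injective f) (hg : Function.Injective g) :
    ∃ τ : Equiv.Perm β, ∀ a, τ (f a) = g a := by
  classical
  have := Fintype.ofFinite β
  let e : {b // b ∈ Set.range f} ≃ {b // b ∈ Set.range g} :=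
    (Equiv.ofInjective f hf).symm.trans (Equiv.ofInjective g hg)
  refine ⟨e.extendSubtype, fun a => ?_⟩
  rw [e.extendSubtype_apply_of_mem _ ⟨a, rfl⟩]
  have : (Equiv.ofInjective f hf).symm ⟨f a, a, rfl⟩ = a :=
    (Equiv.ofInjective f hf).symm_apply_apply a
  simp only [e, Equiv.trans_apply, this, Equiv.ofInjective_apply]

theorem measurePreserving_comp_perm {W : Type*} [MeasurableSpace W] (μ : Measure W)
    [SigmaFinite μ] {M : ℕ} (τ : Equiv.Perm (Fin M)) :
    MeasurePreserving (fun x : Fin M → W => x ∘ τ) (Measure.pi fun _ => μ)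
      (Measure.pi fun _ => μ) := by
  have h := measurePreserving_piCongrLeft (fun _ : Fin M => μ) τ.symm
  convert! h using 1
  funext x i
  obtain ⟨j, rfl⟩ := τ.symm.surjective i
  rw [MeasurableEquiv.coe_piCongrLeft, Equiv.piCongrLeft_apply_apply]
  simp

theorem card_filter_injective {m M : ℕ} (hm : m ≤ M) :
    ((Finset.univ.filter fun σ : Fin m → Fin M => Function.Injective σ).card : ℝ) =
      (M.factorial : ℝ) / ((M - m).factorial : ℝ) := by
  classical
  rw [← Fintype.card_subtype, Fintype.card_congr (Equiv.subtypeInjectiveEquivEmbedding _ _),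
    Fintype.card_embedding_eq, Fintype.card_fin, Fintype.card_fin,
    eq_div_iff (by exact_mod_cast (Nat.factorial_pos _).ne')]
  rw [mul_comm]
  exact_mod_cast Nat.factorial_mul_descFactorial hm

theorem isCorrelationFunction_marginal {W : Type*} [MeasurableSpace W] (μ : Measure W)
    [SigmaFinite μ] {m M : ℕ} (hm : m ≤ M) {f : (Fin M → W) → ℝ} (hf : Measurable f)
    (hf0 : ∀ x, 0 ≤ f x) (hsymm : ∀ (τ : Equiv.Perm (Fin M)) x, f (x ∘ τ) = f x)
    (hint : ∀ y, Integrable (fun x => f (join hm y x)) (Measure.pi fun _ => μ)) :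
    IsCorrelationFunction μ ((Measure.pi fun _ => μ).withDensity fun x => ENNReal.ofReal (f x)) m
      (fun y => (M.factorial : ℝ) / ((M - m).factorial : ℝ) *
        ∫ x, f (join hm y x) ∂(Measure.pi fun _ => μ)) := by
  classical
  have hfj : Measurable fun p : (Fin m → W) × (Fin (M - m) → W) => f (join hm p.1 p.2) :=
    hf.comp (measurable_join hm)
  refine ⟨?_, fun y => ?_, fun B hB hdisj => ?_⟩
  · exact (StronglyMeasurable.integral_prod_right
      (f := fun y x => f (join hm y x)) hfj.stronglyMeasurable).measurable.const_mul _
  · exact mul_nonneg (by positivity) (integral_nonneg fun x => hf0 _)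
  have hind : ∀ k, Measurable ((B k).indicator (1 : W → ENNReal)) :=
    fun k => measurable_one.indicator (hB k)
  have hprodm : ∀ σ : Fin m → Fin M,
      Measurable fun x : Fin M → W => ∏ k, (B k).indicator (1 : W → ENNReal) (x (σ k)) :=
    fun σ => Finset.measurable_fun_prod _ fun k _ => (hind k).comp (measurable_pi_apply _)
  set F : (Fin m → Fin M) → (Fin M → W) → ENNReal := fun σ x =>
    ENNReal.ofReal (f x) * ∏ k, (B k).indicator (1 : W → ENNReal) (x (σ k)) with hF
  have hFm : ∀ σ, Measurable (F σ) := fun σ => hf.ennreal_ofReal.mul (hprodm σ)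
  set σ₀ : Fin m → Fin M := fun k => joinIndex hm (Sum.inl k)
  have hσ₀ : Function.Injective σ₀ := (joinIndex hm).injective.comp Sum.inl_injective
  have hexp : ∀ x : Fin M → W, ∏ k, (occupation (B k) x : ENNReal) =
      ∑ σ : Fin m → Fin M, ∏ k, (B k).indicator (1 : W → ENNReal) (x (σ k)) := fun x => by
    simp only [natCast_occupation]
    rw [Finset.prod_univ_sum, Fintype.piFinset_univ]
  have hinj : ∀ σ, Function.Injective σ →
      ∫⁻ x, F σ x ∂(Measure.pi fun _ => μ) = ∫⁻ x, F σ₀ x ∂(Measure.pi fun _ => μ) := by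
    intro σ hσ
    obtain ⟨τ, hτ⟩ := exists_perm_extending hσ₀ hσ
    rw [← (measurePreserving_comp_perm μ τ).lintegral_comp (hFm σ₀)]
    simp only [hF, hsymm, Function.comp_apply, hτ]
  have hninj : ∀ σ, ¬Function.Injective σ → ∀ x, F σ x = 0 := by
    intro σ hσ x
    obtain ⟨p, q, hpq, hne⟩ : ∃ p q, σ p = σ q ∧ p ≠ q := by
      simpa [Function.Injective] using hσ
    refine mul_eq_zero_of_right _ ?_
    by_cases hp : x (σ p) ∈ B p
    · refine Finset.prod_eq_zero (Finset.mem_univ q) (Set.indicator_of_notMem (fun hq => ?_) _)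
      rw [← hpq] at hq
      exact Set.disjoint_left.1 (hdisj hne) hp hq
    · exact Finset.prod_eq_zero (Finset.mem_univ p) (Set.indicator_of_notMem hp _)
  have hσ₀int : ∫⁻ x, F σ₀ x ∂(Measure.pi fun _ => μ) =
      ∫⁻ y in Set.univ.pi B, ENNReal.ofReal (∫ x, f (join hm y x) ∂(Measure.pi fun _ => μ))
        ∂(Measure.pi fun _ => μ) := by
    rw [← (measurePreserving_join hm μ).lintegral_comp (hFm σ₀),
      lintegral_prod (fun p => F σ₀ (join hm p.1 p.2))
        ((hFm σ₀).comp (measurable_join hm)).aemeasurable,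
      ← lintegral_indicator (MeasurableSet.univ_pi hB)]
    refine lintegral_congr fun y => ?_
    simp only [hF, σ₀, join_inl, prod_indicator_eq]
    have hfy : Measurable fun x => ENNReal.ofReal (f (join hm y x)) :=
      (hfj.comp (measurable_const.prodMk measurable_id)).ennreal_ofReal
    rw [lintegral_mul_const _ hfy,
      ← ofReal_integral_eq_lintegral_ofReal (hint y) (Filter.Eventually.of_forall fun x => hf0 _)]
    by_cases hy : y ∈ Set.univ.pi B
    · simp only [Set.indicator_of_mem hy, Pi.one_apply, mul_one]
    · simp only [Set.indicator_of_notMem hy, mul_zero]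
  calc ∫⁻ x, ∏ k, (occupation (B k) x : ENNReal)
        ∂((Measure.pi fun _ => μ).withDensity fun x => ENNReal.ofReal (f x))
      = ∫⁻ x, ∑ σ, F σ x ∂(Measure.pi fun _ => μ) := by
        simp only [hexp]
        rw [lintegral_withDensity_eq_lintegral_mul _ hf.ennreal_ofReal
          (Finset.measurable_fun_sum _ fun σ _ => hprodm σ)]
        simp only [Pi.mul_apply, Finset.mul_sum, hF]
    _ = ∑ σ, ∫⁻ x, F σ x ∂(Measure.pi fun _ => μ) := lintegral_finsetSum _ fun σ _ => hFm σ
    _ = ∑ σ ∈ Finset.univ.filter fun σ : Fin m → Fin M => Function.Injective σ,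
          ∫⁻ x, F σ₀ x ∂(Measure.pi fun _ => μ) := by
        rw [Finset.sum_filter]
        refine Finset.sum_congr rfl fun σ _ => ?_
        split_ifs with h
        · exact hinj σ h
        · simp [hninj σ h]
    _ = ENNReal.ofReal ((M.factorial : ℝ) / ((M - m).factorial : ℝ)) *
          ∫⁻ x, F σ₀ x ∂(Measure.pi fun _ => μ) := by
        rw [Finset.sum_const, nsmul_eq_mul, ← card_filter_injective hm, ENNReal.ofReal_natCast]
    _ = _ := by
        rw [hσ₀int, ← lintegral_const_mul' _ _ ENNReal.ofReal_ne_top]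
        refine lintegral_congr fun y => ?_
        rw [ENNReal.ofReal_mul (by positivity)]

/-! ### Uniqueness of correlation functions -/

theorem ae_injective {W : Type*} [MeasurableSpace W] [MeasurableEq W] (μ : Measure W)
    [SigmaFinite μ] [NullSingletonClass μ] (m : ℕ) :
    ∀ᵐ y ∂(Measure.pi fun _ : Fin m => μ), Function.Injective y := by
  have h : ∀ i j : Fin m, i ≠ j → ∀ᵐ y ∂(Measure.pi fun _ : Fin m => μ), y i ≠ y j := by
    rcases m with _ | n
    · exact fun i => i.elim0
    intro i j hij
    obtain ⟨j', rfl⟩ := Fin.exists_succAbove_eq hij.symm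
    have hmp := measurePreserving_piFinSuccAbove (fun _ : Fin (n + 1) => μ) i
    have hs : MeasurableSet {p : W × (Fin n → W) | p.1 = p.2 j'} :=
      measurableSet_eq_fun measurable_fst ((measurable_pi_apply j').comp measurable_snd)
    have h0 : (μ.prod (Measure.pi fun _ : Fin n => μ)) {p : W × (Fin n → W) | p.1 = p.2 j'} = 0 := by
      rw [Measure.prod_apply_symm hs]
      simp
    have := hmp.measure_preimage hs.nullMeasurableSet
    rw [h0] at this
    rw [ae_iff]
    simp only [ne_eq, not_not]
    exact this
  have h' : ∀ᵐ y ∂(Measure.pi fun _ : Fin m => μ), ∀ i j : Fin m, i ≠ j → y i ≠ y j := by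
    rw [ae_all_iff]
    intro i
    rw [ae_all_iff]
    intro j
    by_cases hij : i = j
    · simp [hij]
    · filter_upwards [h i j hij] with y hy _ using hy
  filter_upwards [h'] with y hy i j hij
  by_contra hne
  exact hy i j hne hij

theorem occupation_le {W : Type*} {M : ℕ} (B : Set W) (x : Fin M → W) : occupation B x ≤ M := by
  classical
  exact (Finset.card_filter_le _ _).trans (by simp)

theorem IsCorrelationFunction.ae_eq_restrict {W : Type*} [MeasurableSpace W] {μ : Measure W}
    {m M : ℕ} {P : Measure (Fin M → W)} [IsFiniteMeasure P] {R R' : (Fin m → W) → ℝ}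
    (hR : IsCorrelationFunction μ P m R) (hR' : IsCorrelationFunction μ P m R')
    {B : Fin m → Set W} (hB : ∀ k, MeasurableSet (B k))
    (hdisj : Pairwise fun j k => Disjoint (B j) (B k)) :
    R =ᵐ[(Measure.pi fun _ => μ).restrict (Set.univ.pi B)] R' := by
  have hfin : ∫⁻ y in Set.univ.pi B, ENNReal.ofReal (R y) ∂(Measure.pi fun _ => μ) ≠ ⊤ := by
    rw [← hR.expectation_eq B hB hdisj]
    refine ne_top_of_le_ne_top (b := ∫⁻ _, (M : ENNReal) ^ m ∂P) ?_ (lintegral_mono fun x => ?_)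
    · rw [lintegral_const]
      exact ENNReal.mul_ne_top (ENNReal.pow_ne_top (ENNReal.natCast_ne_top M))
        (measure_ne_top _ _)
    · calc ∏ k, (occupation (B k) x : ENNReal) ≤ ∏ _k : Fin m, (M : ENNReal) :=
            Finset.prod_le_prod' fun k _ => by exact_mod_cast occupation_le (B k) x
        _ = (M : ENNReal) ^ m := by simp
  set ν := (Measure.pi fun _ : Fin m => μ).restrict (Set.univ.pi B)
  have hfinm : IsFiniteMeasure (ν.withDensity fun y => ENNReal.ofReal (R y)) :=
    isFiniteMeasure_withDensity hfin
  have hbox : ∀ C : Fin m → Set W, (∀ k, MeasurableSet (C k)) →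
      ∀ {Q}, IsCorrelationFunction μ P m Q →
      (ν.withDensity fun y => ENNReal.ofReal (Q y)) (Set.univ.pi C) =
        ∫⁻ x, ∏ k, (occupation (C k ∩ B k) x : ENNReal) ∂P := by
    intro C hC Q hQ
    rw [hQ.expectation_eq (fun k => C k ∩ B k) (fun k => (hC k).inter (hB k))
      (fun j k hjk => (hdisj hjk).mono Set.inter_subset_right Set.inter_subset_right),
      withDensity_apply _ (MeasurableSet.univ_pi hC),
      Measure.restrict_restrict (MeasurableSet.univ_pi hC), Set.pi_inter_distrib]
  have heq : (ν.withDensity fun y => ENNReal.ofReal (R y)) =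
      ν.withDensity fun y => ENNReal.ofReal (R' y) := by
    refine ext_of_generate_finite _ generateFrom_pi.symm isPiSystem_pi ?_ ?_
    · rintro _ ⟨C, hC, rfl⟩
      have hC' : ∀ k, MeasurableSet (C k) := fun k => hC k (Set.mem_univ k)
      rw [hbox C hC' hR, hbox C hC' hR']
    · rw [← Set.pi_univ Set.univ, hbox _ (fun _ => MeasurableSet.univ) hR,
        hbox _ (fun _ => MeasurableSet.univ) hR']
  have hae := (withDensity_eq_iff hR.measurable.ennreal_ofReal.aemeasurable
    hR'.measurable.ennreal_ofReal.aemeasurable hfin).1 heq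
  filter_upwards [hae] with y hy
  exact (ENNReal.ofReal_eq_ofReal_iff (hR.nonneg y) (hR'.nonneg y)).1 hy

/-- Correlation functions with respect to an atomless measure are unique up to null sets. -/
theorem IsCorrelationFunction.ae_eq {W : Type*} [TopologicalSpace W] [T2Space W]
    [SecondCountableTopology W] [MeasurableSpace W] [BorelSpace W] {μ : Measure W}
    [SigmaFinite μ] [NullSingletonClass μ] {m M : ℕ} {P : Measure (Fin M → W)}
    [IsFiniteMeasure P] {R R' : (Fin m → W) → ℝ}
    (hR : IsCorrelationFunction μ P m R) (hR' : IsCorrelationFunction μ P m R') :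
    R =ᵐ[Measure.pi fun _ => μ] R' := by
  have hbasis := TopologicalSpace.isBasis_countableBasis W
  have : Countable (TopologicalSpace.countableBasis W) :=
    (TopologicalSpace.countable_countableBasis W).to_subtype
  have hall : ∀ᵐ y ∂(Measure.pi fun _ : Fin m => μ),
      ∀ B : Fin m → TopologicalSpace.countableBasis W,
        (Pairwise fun j k => Disjoint (B j : Set W) (B k : Set W)) →
        y ∈ Set.univ.pi (fun k => (B k : Set W)) → R y = R' y := by
    rw [ae_all_iff]
    intro B
    have hB : ∀ k, MeasurableSet (B k : Set W) := fun k => (hbasis.isOpen (B k).2).measurableSet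
    by_cases hd : Pairwise fun j k => Disjoint (B j : Set W) (B k : Set W)
    · have := (ae_restrict_iff' (MeasurableSet.univ_pi hB)).1 (hR.ae_eq_restrict hR' hB hd)
      filter_upwards [this] with y hy _ hyB using hy hyB
    · exact Filter.Eventually.of_forall fun y h => absurd h hd
  filter_upwards [hall, ae_injective μ m] with y hy hinj
  obtain ⟨s, hs, hsd⟩ := Pairwise.exists_mem_filter_of_disjoint (l := fun k => nhds (y k))
    fun i j hij => disjoint_nhds_nhds.2 (hinj.ne hij)
  choose b hb hyb hbs using fun k => hbasis.mem_nhds_iff.1 (hs k)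
  exact hy (fun k => ⟨b k, hb k⟩) (fun i j hij => (hsd hij).mono (hbs i) (hbs j))
    fun k _ => hyb k

/-! ### The correlation functions of the circular ensemble -/

instance : NullSingletonClass haarCircle := by
  have : Nontrivial Circle := ⟨1, -1, fun h => by
    have := congrArg ((↑) : Circle → ℂ) h
    simp only [Circle.coe_one, Circle.coe_neg] at this
    norm_num [eq_neg_iff_add_eq_zero] at this⟩
  have : (nhdsWithin (1 : Circle) {1}ᶜ).NeBot := PerfectSpace.not_isolated 1
  exact Measure.IsHaarMeasure.nullSingletonClass haarCircle

theorem absVandermonde_nonneg (β : ℕ) {n : ℕ} (x : Fin n → Circle) : 0 ≤ absVandermonde β x :=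
  Finset.prod_nonneg fun _ _ => Finset.prod_nonneg fun _ _ => by positivity

theorem continuous_absVandermonde (β n : ℕ) :
    Continuous fun x : Fin n → Circle => absVandermonde β x :=
  continuous_finsetProd _ fun k _ => continuous_finsetProd _ fun j _ =>
    (((continuous_coe_circle.comp (continuous_apply k)).sub
      (continuous_coe_circle.comp (continuous_apply j))).norm).pow _

theorem absVandermonde_comp_perm (c : ℕ) {n : ℕ} (τ : Equiv.Perm (Fin n)) (x : Fin n → Circle) :
    absVandermonde (2 * c) (x ∘ τ) = absVandermonde (2 * c) x := by
  have h : (absVandermonde (2 * c) (x ∘ τ) : ℂ) = absVandermonde (2 * c) x := by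
    rw [absVandermonde_eq_dysonProd, absVandermonde_eq_dysonProd, dysonProd, dysonProd]
    have hτ : ∀ F : Fin n → Fin n → ℂ, ∏ i, ∏ j, F (τ i) (τ j) = ∏ i, ∏ j, F i j := fun F => by
      rw [← Equiv.prod_comp τ fun i => ∏ j, F i j]
      exact Finset.prod_congr rfl fun i _ => Equiv.prod_comp τ (F (τ i))
    rw [← hτ fun i j : Fin n => if i = j then 1 else (1 - (x i : ℂ) * (x j : ℂ)⁻¹) ^ c]
    simp only [Function.comp_apply, EmbeddingLike.apply_eq_iff_eq]
  exact_mod_cast h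

theorem absVandermonde_join (β : ℕ) {m M : ℕ} (hm : m ≤ M) (y : Fin m → Circle)
    (x : Fin (M - m) → Circle) :
    absVandermonde β (join hm y x) = absVandermonde β y *
      (absVandermonde β x * ∏ k, ∏ j, ‖(x k : ℂ) - (y j : ℂ)‖ ^ β) := by
  have h : ∀ {n : ℕ} (f : Fin n → Fin n → ℝ), ∏ k, ∏ j ∈ Finset.Iio k, f k j =
      ∏ k, ∏ j, if j < k then f k j else 1 := fun f => by
    refine Finset.prod_congr rfl fun k _ => ?_
    rw [← Finset.prod_filter]
    congr 1
    ext j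
    simp
  have hsplit : ∀ F : Fin M → Fin M → ℝ, ∏ k, ∏ j, F k j =
      ∏ k, ∏ j, F (joinIndex hm k) (joinIndex hm j) := fun F => by
    rw [← Equiv.prod_comp (joinIndex hm)]
    exact Finset.prod_congr rfl fun k _ => (Equiv.prod_comp (joinIndex hm) _).symm
  simp only [absVandermonde, h]
  rw [hsplit]
  simp only [Fintype.prod_sum_type, join_inl, join_inr]
  have hll : ∀ i j : Fin m, joinIndex hm (Sum.inl i) < joinIndex hm (Sum.inl j) ↔ i < j := by
    intro i j; simp [joinIndex, Fin.lt_def, -Fin.val_fin_lt]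
  have hrr : ∀ i j : Fin (M - m),
      joinIndex hm (Sum.inr i) < joinIndex hm (Sum.inr j) ↔ i < j := by
    intro i j; simp [joinIndex]
  have hlr : ∀ (i : Fin m) (j : Fin (M - m)),
      joinIndex hm (Sum.inl i) < joinIndex hm (Sum.inr j) := by
    intro i j; rw [Fin.lt_def]; simp [joinIndex]; omega
  have hrl : ∀ (i : Fin (M - m)) (j : Fin m),
      ¬joinIndex hm (Sum.inr i) < joinIndex hm (Sum.inl j) := fun i j => (hlr j i).not_gt
  simp only [hll, hrr, hlr, hrl, if_true, if_false, Finset.prod_const_one, mul_one,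
    Finset.prod_mul_distrib]
  ring

theorem correlation_eq (c : ℕ) {m M : ℕ} (hm : m ≤ M) (y : Fin m → Circle) :
    correlation (2 * c) hm y = (M.factorial : ℝ) / ((M - m).factorial : ℝ) *
      ((Nat.multinomial (Finset.univ : Finset (Fin M)) fun _ => c : ℝ)⁻¹ *
        (absVandermonde (2 * c) y * ∫ x : Fin (M - m) → Circle, absVandermonde (2 * c) x *
          ∏ k, ∏ j, ‖(x k : ℂ) - (y j : ℂ)‖ ^ (2 * c) ∂(haarTorus (M - m)))) := by
  have hM : (M.factorial : ℝ) ≠ 0 := by exact_mod_cast (Nat.factorial_pos _).ne'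
  have hZ : (M.factorial : ℝ) * partitionFunction (2 * c) M =
      (Nat.multinomial (Finset.univ : Finset (Fin M)) fun _ => c : ℝ) := by
    rw [partitionFunction, integral_absVandermonde]
    field_simp
  rw [correlation]
  change _ * ∫ x, jointDensity (2 * c) M (join hm y x) ∂(haarTorus (M - m)) = _
  simp only [jointDensity, hZ, absVandermonde_join]
  rw [integral_const_mul, integral_const_mul, one_div]

theorem jointDensity_nonneg (β M : ℕ) (x : Fin M → Circle) : 0 ≤ jointDensity β M x := by
  have : 0 ≤ partitionFunction β M :=
    mul_nonneg (by positivity) (integral_nonneg fun x => absVandermonde_nonneg β x)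
  exact mul_nonneg (by positivity) (absVandermonde_nonneg β x)

theorem continuous_jointDensity (β M : ℕ) : Continuous (jointDensity β M) :=
  continuous_const.mul (continuous_absVandermonde β M)

instance (β M : ℕ) : IsFiniteMeasure (circularEnsemble β M) :=
  isFiniteMeasure_withDensity_ofReal
    (integrable_of_continuous_of_compactSpace (continuous_jointDensity β M)).2

theorem isCorrelationFunction_correlation (c : ℕ) {m M : ℕ} (hm : m ≤ M) :
    IsCorrelationFunction haarCircle (circularEnsemble (2 * c) M) m (correlation (2 * c) hm) :=
  isCorrelationFunction_marginal haarCircle hm (continuous_jointDensity _ M).measurable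
    (jointDensity_nonneg _ M)
    (fun τ x => by rw [jointDensity, jointDensity, absVandermonde_comp_perm])
    fun y => integrable_of_continuous_of_compactSpace
      ((continuous_jointDensity _ M).comp (continuous_join hm y))

theorem correlation_eq_hyperpfaffian (L M m : ℕ) (hL : Even L) (hL0 : 0 < L) (hm : m ≤ M)
    (y : Fin m → Circle) :
    (correlation (L ^ 2) hm y : ℂ) =
      (M.factorial : ℂ) *
        (Nat.multinomial (Finset.univ : Finset (Fin M)) (fun _ => L ^ 2 / 2) : ℂ)⁻¹ *
        (∏ k, ∏ j ∈ Finset.Iio k, ((‖(y k : ℂ) - (y j : ℂ)‖ : ℝ) : ℂ) ^ (L ^ 2)) *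
        (∏ n, (y n : ℂ) ^ (-((L ^ 2 * (M - m) / 2 : ℕ) : ℤ))) *
        hyperpfaffian L (M - m) (gammaVec L (M - m) y) := by
  have h2 : L ^ 2 = 2 * (L ^ 2 / 2) :=
    (Nat.mul_div_cancel' (hL.two_dvd.trans (dvd_pow_self L two_ne_zero))).symm
  have hcorr := correlation_eq (L ^ 2 / 2) hm y
  rw [← h2] at hcorr
  have hint := integral_absVandermonde_mul_prod L (M - m) hL hL0 y
  rw [hcorr]
  push_cast
  rw [← integral_complex_ofReal]
  push_cast
  rw [hint, hyperpfaffian]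
  have hsmul : ∀ (a : ℂ) ω, hodgeStarTop (L * (M - m)) (a • ω) =
      a * hodgeStarTop (L * (M - m)) ω := fun a ω => by simp [hodgeStarTop]
  rw [hsmul, absVandermonde]
  push_cast
  ring

end HyperPf

end

theorem mainTheorem2 (L M m : ℕ) (hL : Even L) (hL0 : 0 < L) (hm : 1 ≤ m) (hmM : m ≤ M) :
    -- the marginal-density version of `R_m` is given everywhere by the hyperpfaffian formula
    (∀ y : Fin m → Circle,
      (HyperPf.correlation (L ^ 2) hmM y : ℂ) =
        (M.factorial : ℂ) *
          (Nat.multinomial (Finset.univ : Finset (Fin M)) (fun _ => L ^ 2 / 2) : ℂ)⁻¹ *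
          (∏ k, ∏ j ∈ Finset.Iio k, ((‖(y k : ℂ) - (y j : ℂ)‖ : ℝ) : ℂ) ^ (L ^ 2)) *
          (∏ n, (y n : ℂ) ^ (-((L ^ 2 * (M - m) / 2 : ℕ) : ℤ))) *
          HyperPf.hyperpfaffian L (M - m) (HyperPf.gammaVec L (M - m) y)) ∧
    -- it is an `m`-th correlation function of the ensemble, and the only one up to null sets
    HyperPf.IsCorrelationFunction HyperPf.haarCircle (HyperPf.circularEnsemble (L ^ 2) M) m
        (HyperPf.correlation (L ^ 2) hmM) ∧
    (∀ R : (Fin m → Circle) → ℝ,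
      HyperPf.IsCorrelationFunction HyperPf.haarCircle (HyperPf.circularEnsemble (L ^ 2) M) m R →
      ∀ᵐ y ∂(MeasureTheory.Measure.pi fun _ : Fin m => HyperPf.haarCircle),
        R y = HyperPf.correlation (L ^ 2) hmM y) := by
  have h2 : L ^ 2 = 2 * (L ^ 2 / 2) :=
    (Nat.mul_div_cancel' (hL.two_dvd.trans (dvd_pow_self L two_ne_zero))).symm
  have hcorr := HyperPf.isCorrelationFunction_correlation (L ^ 2 / 2) hmM
  rw [← h2] at hcorr
  exact ⟨HyperPf.correlation_eq_hyperpfaffian L M m hL hL0 hmM, hcorr,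
    fun R hR => hR.ae_eq hcorr⟩
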